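/- A \emph{two-way nondeterministic finite automaton} (2NFA) has a finite input alphabet $\Sigma$, a finite set of states $Q$, a set of initial states $Q_0\subseteq Q$, a transition function $\delta\colon Q\times(\Sigma\cup\{\vdash,\dashv\})\to\mathcal P(Q\times\{-1,+1\})$, where $\vdash,\dashv\notin\Sigma$ are the end-markers, and a set of accepting states $F\subseteq Q$ with $\delta(q,\dashv)=\emptyset$ for all $q\in F$. On an input $w=a_1\cdots a_\ell$, with $a_0=\vdash$ and $a_{\ell+1}=\dashv$, it moves from a configuration $(p,k)$ to $(p',k')$, where $0\le k,k'\le \ell+1$, if $(p',k'-k)\in\delta(p,a_k)$; it accepts $w$ if some configuration $(q,\ell+1)$ with $q\in F$ is reachable from some $(q_0,0)$ with $q_0\in Q_0$. A one-way nondeterministic finite automaton (NFA), possibly with several initial states, is \emph{unambiguous} (a UFA) if every string has at most one accepting computation. Let $n$ be a positive integer and $[n]=\{1,\dots,n\}$. A \emph{prefix table} is a function $f\colon[n]\to\mathcal P([n])\setminus\{\emptyset\}$ such that for some $i$, $f(i)\subseteq f(j)$ for all $j$. A \emph{suffix table} is a function $g\colon[n]\to\mathcal P([n]\cup\{\mathrm{Accept}\})$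 such that $\mathrm{Accept}\in g(i)$ for some $i$, and $g(i)=[n]\cup\{\mathrm{Accept}\}$ whenever $\mathrm{Accept}\in g(i)$. Let $\Gamma_n$ be the finite alphabet consisting of the symbols $(\mathrm L,i)$ for $i\in[n]$, $(\mathrm L,f)$ for prefix tables $f$, and $(\mathrm R,g)$ for suffix tables $g$. Let $\mathcal A_n$ be the $n$-state 2NFA over $\Gamma_n$ with set of states $[n]$, initial state $1$, all states accepting, and transitions $\delta(q,\vdash)=\{(q,+1)\}$, $\delta(q,\dashv)=\emptyset$, $\delta(q,(\mathrm L,i))=\{(i,+1)\}$, $\delta(q,(\mathrm L,f))=f(q)\times\{+1\}$, and $\delta(q,(\mathrm R,g))=\{(q,+1)\}$ if $\mathrm{Accept}\in g(q)$, and $g(q)\times\{-1\}$ otherwise. \textbf{Theorem.} For every positive integer $n$, every UFA that recognizes the language $L_n$ of the $n$-state 2NFA $\mathcal A_n$ has at least $$\sum_{k=1}^{n}(k-1)!\,k!\,S(n,k)\,S(n+1,k)$$ states, where $S(m,k)$ denotes the Stirling numbers of the second kind. In particular, for every $n$ there is a language recognized by a 2NFA with $n$ states such that every UFA for it has at least this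 many states. -/

import Mathlib

/-! ### One-way unambiguous automata -/

namespace NFA

variable {α σ : Type*}

/-- An accepting computation `p 0, p 1, …, p ℓ` of a (one-way) NFA on a string of length `ℓ`. -/
def IsAcceptingRun (M : NFA α σ) (w : List α) (p : Fin (w.length + 1) → σ) : Prop :=
  p 0 ∈ M.start ∧
  (∀ i : Fin w.length, p i.succ ∈ M.step (p i.castSucc) (w.get i)) ∧
  p (Fin.last w.length) ∈ M.accept

/-- An NFA is unambiguous if every string has at most one accepting computation. -/
def IsUnambiguous (M : NFA α σ) : Prop :=
  ∀ (w : List α) (p p' : Fin (w.length + 1) → σ),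
    M.IsAcceptingRun w p → M.IsAcceptingRun w p' → p = p'

end NFA

/-! ### Two-way nondeterministic automata -/

/-- Directions of head moves: `left` is `-1`, `right` is `+1`. -/
inductive HeadMove : Type
  | left
  | right

/-- Tape symbols: the left end-marker, the input symbols and the right end-marker. -/
inductive TapeSymbol (α : Type*) : Type _
  | leftEnd
  | letter (a : α)
  | rightEnd

/-- A two-way nondeterministic automaton with input alphabet `α` and set of states `σ`
(both are finite wherever this structure is used). -/
structure TwoNFA (α σ : Type*) where
  step : σ → TapeSymbol α → Set (σ × HeadMove)
  start : Set σ
  accept : Set σ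
  step_accept : ∀ q ∈ accept, step q TapeSymbol.rightEnd = ∅

namespace TwoNFA

variable {α σ : Type*}

/-- The symbol at position `k` of the tape holding `w = a₁ … a_ℓ` between the end-markers:
the left end-marker at position `0`, the letter `a_k` at position `1 ≤ k ≤ ℓ`,
and the right end-marker at position `ℓ + 1`. (Positions beyond `ℓ + 1` are never visited.) -/
def symbolAt (w : List α) : ℕ → TapeSymbol α
  | 0 => TapeSymbol.leftEnd
  | k + 1 =>
    match w[k]? with
    | some a => TapeSymbol.letter a
    | none => TapeSymbol.rightEnd

/-- One move of the automaton between configurations `(state, head position)` on the input `w`.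
The head stays within the positions `0, …, ℓ + 1`. -/
def Move (A : TwoNFA α σ) (w : List α) (c d : σ × ℕ) : Prop :=
  d.2 ≤ w.length + 1 ∧
  (((d.1, HeadMove.right) ∈ A.step c.1 (symbolAt w c.2) ∧ d.2 = c.2 + 1) ∨
   ((d.1, HeadMove.left) ∈ A.step c.1 (symbolAt w c.2) ∧ d.2 + 1 = c.2))

/-- A string of length `ℓ` is accepted if some computation starting in an initial state at
position `0` reaches an accepting state at position `ℓ + 1`. By `not_move_of_accept` such a
computation cannot be continued, that is, it is automatically a maximal one. -/
def language (A : TwoNFA α σ) : Language α :=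
  {w | ∃ q₀ ∈ A.start, ∃ q ∈ A.accept,
    Relation.ReflTransGen (A.Move w) (q₀, 0) (q, w.length + 1)}

theorem not_move_of_accept (A : TwoNFA α σ) (w : List α) {q : σ} (hq : q ∈ A.accept)
    (d : σ × ℕ) : ¬ A.Move w (q, w.length + 1) d := by
  have h : symbolAt w (w.length + 1) = TapeSymbol.rightEnd := by simp [symbolAt]
  simp [Move, h, A.step_accept q hq]

end TwoNFA

/-! ### The universal two-way automaton; `Fin n` plays the role of `[n] = {1, …, n}` -/

/-- Prefix tables: functions from `[n]` to nonempty subsets of `[n]`, one value of which is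
contained in all the others. -/
def PrefixTable (n : ℕ) : Type :=
  {f : Fin n → Finset (Fin n) // (∀ i, (f i).Nonempty) ∧ ∃ i, ∀ j, f i ⊆ f j}

/-- Suffix tables: functions from `[n]` to subsets of `[n] ∪ {Accept}`, where `none` stands for
`Accept`; some value contains `Accept`, and each value that contains it is the whole set. -/
def SuffixTable (n : ℕ) : Type :=
  {g : Fin n → Finset (Option (Fin n)) //
    (∃ i, none ∈ g i) ∧ ∀ i, none ∈ g i → g i = Finset.univ}

/-- The alphabet `Γ_n`. -/
inductive UniversalAlphabet (n : ℕ) : Type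
  | leftState (i : Fin n)
  | leftTable (f : PrefixTable n)
  | rightTable (g : SuffixTable n)

instance (n : ℕ) : Finite (PrefixTable n) := by
  unfold PrefixTable
  infer_instance

instance (n : ℕ) : Finite (SuffixTable n) := by
  unfold SuffixTable
  infer_instance

instance (n : ℕ) : Finite (UniversalAlphabet n) := by
  refine Finite.of_surjective
    (fun x : Fin n ⊕ PrefixTable n ⊕ SuffixTable n =>
      Sum.elim UniversalAlphabet.leftState
        (Sum.elim UniversalAlphabet.leftTable UniversalAlphabet.rightTable) x) ?_
  rintro (i | f | g)
  · exact ⟨Sum.inl i, rfl⟩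
  · exact ⟨Sum.inr (Sum.inl f), rfl⟩
  · exact ⟨Sum.inr (Sum.inr g), rfl⟩

/-- The transition function of the universal automaton. At the left end-marker it moves right
without changing its state, at the right end-marker it has no transitions. -/
def universalStep (n : ℕ) (q : Fin n) :
    TapeSymbol (UniversalAlphabet n) → Set (Fin n × HeadMove)
  | .leftEnd => {(q, HeadMove.right)}
  | .letter (.leftState i) => {(i, HeadMove.right)}
  | .letter (.leftTable f) => {x | x.1 ∈ f.1 q ∧ x.2 = HeadMove.right}
  | .letter (.rightTable g) =>
      if none ∈ g.1 q then {(q, HeadMove.right)}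
      else {x | some x.1 ∈ g.1 q ∧ x.2 = HeadMove.left}
  | .rightEnd => ∅

/-- The universal automaton `A_n`: its states are `[n]`, the initial state is the first one,
and all states are accepting. -/
def universalTwoNFA (n : ℕ) : TwoNFA (UniversalAlphabet n) (Fin n) where
  step := universalStep n
  start := {q | (q : ℕ) = 0}
  accept := Set.univ
  step_accept := fun _ _ => rfl

/-!
The languages `{v | u ++ v ∈ L}` of the words `u` are the rows of the acceptance matrix of `L`. In a
UFA each accepted word passes through exactly one state after its prefix `u`, so the row of `u` is
the sum of the rows of the states reached by `u`, over any ring, and the rank of the matrix bounds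
the number of states from below. The theorem is a lower bound on the rank modulo two.

The rows used are those of words `(L, i)(L, f)` where the values of `f` form a chain of `k` sets and
`f i` is the least of them. The columns used are those of suffix tables given by levels: the table
moves from `q` to the states of level at most that of `q`, and a computation is accepted once it
reaches level `k`, which it does iff it can leave each lower level upwards. Start from the levels of
one chain table and raise some of them by one. Summing over all choices of the raised elements
modulo two, the acceptance conditions cancel unless they come from the same chain table, or from one
with more values. So the rows are triangular with respect to these combinations of columns.

A chain table with `k` values is a surjection onto `k` levels together with a map onto `k` levels
that may also take one more value, whence the product of two Stirling numbers.
-/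

/-! ### Counting surjections -/

theorem card_compl_singleton_subset_range {α β : Type*} [Finite α] [Finite β] (v : β) :
    Nat.card {f : α → β // {v}ᶜ ⊆ Set.range f} =
      Nat.card {f : α → β // f.Surjective} +
        Nat.card {f : α → ({v}ᶜ : Set β) // f.Surjective} := by
  have hunion : {f : α → β | {v}ᶜ ⊆ Set.range f} = {f | f.Surjective} ∪
      (Subtype.val ∘ ·) '' {f : α → ({v}ᶜ : Set β) | f.Surjective} := by
    ext f
    simp only [Set.mem_ofPred_eq, Set.mem_union, Set.mem_image]
    constructor
    · intro hf
      by_cases hv : v ∈ Set.range f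
      · exact .inl fun y => (eq_or_ne y v).elim (· ▸ hv) (hf ·)
      · refine .inr ⟨fun x => ⟨f x, fun h => hv ⟨x, h⟩⟩, fun y => ?_, rfl⟩
        obtain ⟨x, hx⟩ := hf y.2
        exact ⟨x, Subtype.ext hx⟩
    · rintro (hf | ⟨g, hg, rfl⟩) y hy
      · exact hf y
      · obtain ⟨x, hx⟩ := hg ⟨y, hy⟩
        exact ⟨x, congrArg Subtype.val hx⟩
  have hdisjoint : Disjoint {f : α → β | f.Surjective}
      ((Subtype.val ∘ ·) '' {f : α → ({v}ᶜ : Set β) | f.Surjective}) := by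
    rw [Set.disjoint_left]
    rintro _ hf ⟨g, -, rfl⟩
    obtain ⟨x, hx⟩ := hf v
    exact (g x).2 hx
  have hinjective : Function.Injective
      (Subtype.val ∘ · : (α → ({v}ᶜ : Set β)) → α → β) :=
    Subtype.val_injective.comp_left
  have hcard := congrArg Set.ncard hunion
  rwa [Set.ncard_union_eq hdisjoint, Set.ncard_image_of_injective _ hinjective] at hcard

theorem surjective_cons_iff {β : Type*} {n : ℕ} {v : β} {f : Fin n → β} :
    (Fin.cons v f : Fin (n + 1) → β).Surjective ↔ {v}ᶜ ⊆ Set.range f := by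
  rw [← Set.range_eq_univ, Fin.range_cons, Set.insert_eq, ← Set.compl_subset_iff_union]

theorem card_surjective_fin (n : ℕ) {β : Type*} [Finite β] :
    Nat.card {f : Fin n → β // f.Surjective} =
      (Nat.card β).factorial * Nat.stirlingSecond n (Nat.card β) := by
  induction n generalizing β with
  | zero =>
    rcases isEmpty_or_nonempty β with hβ | hβ
    · simp [Function.Surjective]
    · have : IsEmpty {f : Fin 0 → β // f.Surjective} :=
        ⟨fun f => hβ.elim fun y => (f.2 y).elim fun x _ => x.elim0⟩
      obtain ⟨m, hm⟩ := Nat.exists_eq_succ_of_ne_zero (Nat.card_pos (α := β)).ne'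
      simp [hm]
  | succ n ih =>
    have e : {f : Fin (n + 1) → β // f.Surjective} ≃
        (v : β) × {f : Fin n → β // {v}ᶜ ⊆ Set.range f} :=
      ((Fin.consEquiv fun _ => β).symm.subtypeEquiv fun f => by
        rw [← surjective_cons_iff]; simp).trans
        (Equiv.subtypeProdEquivSigmaSubtype fun v f => {v}ᶜ ⊆ Set.range f)
    have := Fintype.ofFinite β
    have hcompl (v : β) : Nat.card ({v}ᶜ : Set β) = Nat.card β - 1 := by
      rw [Nat.card_coe_set_eq, Set.ncard_compl, Set.ncard_singleton]
    rw [Nat.card_congr e, Nat.card_sigma]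
    simp only [card_compl_singleton_subset_range, ih, hcompl, Finset.sum_const, Finset.card_univ,
      ← Nat.card_eq_fintype_card, smul_eq_mul]
    rcases Nat.card β with _ | m
    · simp
    · rw [Nat.add_sub_cancel, Nat.stirlingSecond_succ_succ, Nat.factorial_succ]
      ring

theorem card_compl_last_subset_range (n k : ℕ) :
    Nat.card {f : Fin n → Fin (k + 1) // {Fin.last k}ᶜ ⊆ Set.range f} =
      k.factorial * Nat.stirlingSecond (n + 1) (k + 1) := by
  have hcompl : Nat.card ({Fin.last k}ᶜ : Set (Fin (k + 1))) = k := by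
    rw [Nat.card_coe_set_eq, Set.ncard_compl, Set.ncard_singleton, Nat.card_fin,
      Nat.add_sub_cancel]
  rw [card_compl_singleton_subset_range, card_surjective_fin, card_surjective_fin, hcompl,
    Nat.card_fin, Nat.stirlingSecond_succ_succ, Nat.factorial_succ]
  ring

theorem sum_Icc_mul_factorial_mul_stirlingSecond (n : ℕ) :
    ∑ k ∈ Finset.Icc 1 n,
        (k - 1).factorial * k.factorial * Nat.stirlingSecond n k * Nat.stirlingSecond (n + 1) k =
      ∑ k : Fin n, (k + 1 : ℕ).factorial * Nat.stirlingSecond n (k + 1) *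
        ((k + 1 : ℕ).factorial * Nat.stirlingSecond (n + 1) (k + 2)) := by
  rcases n.eq_zero_or_pos with rfl | hn
  · simp
  let u (k : ℕ) : ℕ := k.factorial * Nat.stirlingSecond n k
  have hfirst : u 0 = 0 := by
    obtain ⟨m, rfl⟩ := Nat.exists_eq_add_of_le' hn
    simp [u]
  have hlast : u (n + 1) = 0 := by simp [u, Nat.stirlingSecond_eq_zero_of_lt]
  have hshift : ∑ k ∈ Finset.range n, u k * u (k + 1) =
      ∑ k ∈ Finset.range n, u (k + 1) * u (k + 2) := by
    have h := Finset.sum_range_succ' (fun k => u k * u (k + 1)) n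
    simpa [Finset.sum_range_succ, hfirst, hlast] using h
  calc
    _ = ∑ k ∈ Finset.range n, k.factorial * (k + 1).factorial * Nat.stirlingSecond n (k + 1) *
          Nat.stirlingSecond (n + 1) (k + 1) := by
      rw [Finset.range_eq_Ico, ← Finset.Ico_add_one_right_eq_Icc, ← zero_add 1,
        ← Finset.sum_Ico_add']
      simp only [zero_add, Nat.add_sub_cancel]
    _ = ∑ k ∈ Finset.range n, (u (k + 1) * u (k + 1) + u k * u (k + 1)) := by
      refine Finset.sum_congr rfl fun k _ => ?_
      simp only [u, Nat.stirlingSecond_succ_succ, Nat.factorial_succ]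
      ring
    _ = ∑ k ∈ Finset.range n, (u (k + 1) * u (k + 1) + u (k + 1) * u (k + 2)) := by
      rw [Finset.sum_add_distrib, hshift, ← Finset.sum_add_distrib]
    _ = ∑ k ∈ Finset.range n, (k + 1).factorial * Nat.stirlingSecond n (k + 1) *
          ((k + 1).factorial * Nat.stirlingSecond (n + 1) (k + 2)) := by
      refine Finset.sum_congr rfl fun k _ => ?_
      simp only [u, Nat.stirlingSecond_succ_succ n (k + 1), Nat.factorial_succ (k + 1)]
      ring
    _ = _ := (Fin.sum_univ_eq_sum_range _ n).symm

/-! ### Rank of the acceptance matrix -/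

open Classical in
/-- The Iverson bracket, which turns the truth value of `p` into an element of `R`. -/
noncomputable def iverson (R : Type*) [Zero R] [One R] (p : Prop) : R :=
  if p then 1 else 0

section Iverson

variable (R : Type*) [Zero R] [One R] {p : Prop}

theorem iverson_of_true (hp : p) : iverson R p = 1 :=
  if_pos hp

theorem iverson_of_not (hp : ¬p) : iverson R p = 0 :=
  if_neg hp

theorem iverson_congr {q : Prop} (h : p ↔ q) : iverson R p = iverson R q :=
  congrArg (iverson R) (propext h)

end Iverson

theorem linearIndependent_of_triangular_dual {ι κ R V : Type*} [CommRing R] [AddCommGroup V]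
    [Module R V] [LinearOrder κ] {v : ι → V} (d : ι → κ) (φ : ι → Module.Dual R V)
    (hdiag : ∀ i, φ i (v i) = 1) (htriangular : ∀ i j, j ≠ i → d j ≤ d i → φ i (v j) = 0) :
    LinearIndependent R v := by
  rw [linearIndependent_iff']
  intro s c hc i hi
  classical
  by_contra hci
  obtain ⟨m, hm, hmax⟩ := {i ∈ s | c i ≠ 0}.exists_max_image d ⟨i, by simp [hi, hci]⟩
  rw [Finset.mem_filter] at hm
  have hothers (j) (hj : j ∈ s) (hjm : j ≠ m) : c j * φ m (v j) = 0 := by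
    by_cases hcj : c j = 0
    · rw [hcj, zero_mul]
    · rw [htriangular m j hjm (hmax j (Finset.mem_filter.2 ⟨hj, hcj⟩)), mul_zero]
  have hcm := congrArg (φ m) hc
  simp only [map_sum, map_smul, smul_eq_mul, map_zero] at hcm
  rw [s.sum_eq_single_of_mem m hm.1 hothers, hdiag, mul_one] at hcm
  exact hm.2 hcm

section Unambiguous

variable {α σ : Type*} {M : NFA α σ}

/-- `p 0, p 1, …` are the states of a computation of `M` on `w`, without conditions on the first
and the last state. Runs are indexed by `ℕ`, so that they can be concatenated without casts; the
values beyond `w.length` are arbitrary. -/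
def IsRun (M : NFA α σ) (w : List α) (p : ℕ → σ) : Prop :=
  ∀ i (hi : i < w.length), p (i + 1) ∈ M.step (p i) w[i]

theorem IsRun.exists_append {u v : List α} {q t : σ} {r : ℕ → σ} (hr : IsRun M v r)
    (hr0 : r 0 = q) (hq : q ∈ M.evalFrom {t} u) :
    ∃ p, p 0 = t ∧ IsRun M (u ++ v) p ∧ ∀ i, p (u.length + i) = r i := by
  induction u generalizing t with
  | nil => exact ⟨r, hr0.trans hq, hr, fun i => by rw [List.length_nil, Nat.zero_add]⟩
  | cons a u ih =>
    rw [NFA.evalFrom_cons, NFA.stepSet_singleton, NFA.mem_evalFrom_iff_exists] at hq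
    obtain ⟨s, hs, hq⟩ := hq
    obtain ⟨p, hp0, hp, hpr⟩ := ih hq
    refine ⟨fun i => i.casesOn t p, rfl, ?_, fun i => ?_⟩
    · rintro (_ | i) hi
      · simpa [hp0] using hs
      · exact hp i (Nat.lt_of_succ_lt_succ hi)
    · rw [List.length_cons, Nat.add_right_comm]
      exact hpr i

theorem exists_isAcceptingRun_append {u v : List α} {q : σ} (hu : q ∈ M.eval u)
    (hv : v ∈ M.acceptsFrom {q}) :
    ∃ p, M.IsAcceptingRun (u ++ v) p ∧ p ⟨u.length, by simp⟩ = q := by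
  obtain ⟨s, hs, hsq⟩ := hv
  obtain ⟨t, ht, hqt⟩ := NFA.mem_evalFrom_iff_exists.1 hu
  have hnil : IsRun M [] fun _ => s := fun i hi => absurd hi (Nat.not_lt_zero i)
  obtain ⟨r, hr0, hr, hrs⟩ := hnil.exists_append rfl hsq
  rw [List.append_nil] at hr
  obtain ⟨p, hp0, hp, hpr⟩ := hr.exists_append hr0 hqt
  refine ⟨fun i => p i, ⟨?_, fun i => hp i i.2, ?_⟩, (hpr 0).trans hr0⟩
  · simpa only [Fin.coe_ofNat_eq_mod, Nat.zero_mod, hp0] using ht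
  · simpa only [Fin.val_last, List.length_append, hpr] using hrs 0 ▸ hs

theorem eq_of_mem_eval_of_isUnambiguous (hM : M.IsUnambiguous) {u v : List α} {q q' : σ}
    (hq : q ∈ M.eval u) (hq' : q' ∈ M.eval u) (hv : v ∈ M.acceptsFrom {q})
    (hv' : v ∈ M.acceptsFrom {q'}) : q = q' := by
  obtain ⟨p, hp, rfl⟩ := exists_isAcceptingRun_append hq hv
  obtain ⟨p', hp', rfl⟩ := exists_isAcceptingRun_append hq' hv'
  rw [hM _ p p' hp hp']

theorem append_mem_accepts_iff_exists_mem_eval {u v : List α} :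
    u ++ v ∈ M.accepts ↔ ∃ q ∈ M.eval u, v ∈ M.acceptsFrom {q} := by
  rw [NFA.accepts_eq_acceptsFrom_start, NFA.append_mem_acceptsFrom]
  simp only [NFA.mem_acceptsFrom, NFA.eval, NFA.mem_evalFrom_iff_exists (S := M.evalFrom M.start u)]
  tauto

/-- The row of the word `u` in the acceptance matrix of the language `L`: the entry in the column
of the word `v` tells whether `u ++ v ∈ L`. -/
noncomputable def acceptanceRow (R : Type*) [Zero R] [One R] (L : Language α) (u v : List α) : R :=
  iverson R (u ++ v ∈ L)

theorem acceptanceRow_accepts_eq_sum [Fintype σ] (R : Type*) [Semiring R] (hM : M.IsUnambiguous)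
    (u : List α) [DecidablePred (· ∈ M.eval u)] :
    acceptanceRow R M.accepts u =
      ∑ q with q ∈ M.eval u, fun v => iverson R (v ∈ M.acceptsFrom {q}) := by
  funext v
  rw [Finset.sum_apply, acceptanceRow]
  by_cases huv : u ++ v ∈ M.accepts
  · obtain ⟨q, hq, hv⟩ := append_mem_accepts_iff_exists_mem_eval.1 huv
    rw [Finset.sum_eq_single_of_mem q (by simpa using hq), iverson_of_true R huv,
      iverson_of_true R hv]
    intro q' hq' hne
    rw [Finset.mem_filter_univ] at hq'
    exact iverson_of_not R fun hv' => hne (eq_of_mem_eval_of_isUnambiguous hM hq' hq hv' hv)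
  · rw [iverson_of_not R huv]
    refine (Finset.sum_eq_zero fun q hq => iverson_of_not R fun hv => huv ?_).symm
    rw [Finset.mem_filter_univ] at hq
    exact append_mem_accepts_iff_exists_mem_eval.2 ⟨q, hq, hv⟩

theorem card_le_card_states_of_linearIndependent [Fintype σ] {ι R : Type*} [Fintype ι]
    [Ring R] [StrongRankCondition R] (hM : M.IsUnambiguous) {u : ι → List α}
    (hu : LinearIndependent R fun i => acceptanceRow R M.accepts (u i)) :
    Fintype.card ι ≤ Fintype.card σ := by
  classical
  let row (q : σ) (v : List α) : R := iverson R (v ∈ M.acceptsFrom {q})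
  have hspan : Set.range (fun i => acceptanceRow R M.accepts (u i)) ≤
      Submodule.span R (Set.range row) := by
    rintro _ ⟨i, rfl⟩
    beta_reduce
    rw [acceptanceRow_accepts_eq_sum R hM]
    exact Submodule.sum_mem _ fun q _ => Submodule.subset_span ⟨q, rfl⟩
  exact (linearIndependent_le_span_aux' _ hu _ hspan).trans (Fintype.card_range_le row)

end Unambiguous

/-! ### Crossing the boundary between two tables -/

/-- The state `q` can cross the boundary between the two halves of an input, in the course of a
two-way computation that starts in `i` on the left of it: a computation that is in `x` when it
moves left across the boundary comes back in a state of `f x`, and one that is in `q` when it moves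
right across the boundary comes back in a state of `g q`. -/
inductive Crosses {X Q : Type*} (f : X → Set Q) (g : Q → Set X) (i : X) : Q → Prop
  | start {q} : q ∈ f i → Crosses f g i q
  | turn {q x q'} : Crosses f g i q → x ∈ g q → q' ∈ f x → Crosses f g i q'

namespace SuffixTable

variable {n : ℕ}

/-- The left moves of a suffix table: there are none from the states that lead to acceptance. -/
def returns (g : SuffixTable n) (q : Fin n) : Set (Fin n) :=
  {x | none ∉ g.1 q ∧ some x ∈ g.1 q}

end SuffixTable

section TableWord

variable {n : ℕ} {i : Fin n} {f : PrefixTable n} {g : SuffixTable n}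

theorem universalTwoNFA_move_iff {s s' : Fin n} {m m' : ℕ} :
    (universalTwoNFA n).Move [.leftState i, .leftTable f, .rightTable g] (s, m) (s', m') ↔
      match m with
      | 0 => s' = s ∧ m' = 1
      | 1 => s' = i ∧ m' = 2
      | 2 => s' ∈ f.1 s ∧ m' = 3
      | 3 => (none ∈ g.1 s ∧ s' = s ∧ m' = 4) ∨ (s' ∈ g.returns s ∧ m' = 2)
      | _ => False := by
  rcases m with _ | _ | _ | _ | m
  case succ.succ.succ.zero =>
    by_cases hg : none ∈ g.1 s <;>
      simp +contextual [TwoNFA.Move, TwoNFA.symbolAt, universalTwoNFA, universalStep,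
        SuffixTable.returns, hg]
  all_goals simp +contextual [TwoNFA.Move, TwoNFA.symbolAt, universalTwoNFA, universalStep]

theorem reflTransGen_move_of_crosses (s : Fin n) {q : Fin n}
    (hq : Crosses (fun x => f.1 x) g.returns i q) :
    Relation.ReflTransGen
      ((universalTwoNFA n).Move [.leftState i, .leftTable f, .rightTable g]) (s, 0) (q, 3) := by
  induction hq with
  | start hq =>
    refine .head (b := (s, 1)) ?_ (.head (b := (i, 2)) ?_ (.single ?_)) <;>
      rw [universalTwoNFA_move_iff]
    exacts [⟨rfl, rfl⟩, ⟨rfl, rfl⟩, ⟨hq, rfl⟩]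
  | turn _ hx hq' ih =>
    exact (ih.tail (universalTwoNFA_move_iff.2 (.inr ⟨hx, rfl⟩))).tail
      (universalTwoNFA_move_iff.2 ⟨hq', rfl⟩)

theorem crosses_of_reflTransGen_move {s₀ : Fin n} {d : Fin n × ℕ}
    (h : Relation.ReflTransGen
      ((universalTwoNFA n).Move [.leftState i, .leftTable f, .rightTable g]) (s₀, 0) d) :
    match d with
    | (_, 0) | (_, 1) => True
    | (s, 2) => ∀ q ∈ f.1 s, Crosses (fun x => f.1 x) g.returns i q
    | (s, 3) => Crosses (fun x => f.1 x) g.returns i s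
    | (s, _) => Crosses (fun x => f.1 x) g.returns i s ∧ none ∈ g.1 s := by
  induction h with
  | refl => trivial
  | @tail d d' _ hm ih =>
    obtain ⟨s, m⟩ := d
    obtain ⟨s', m'⟩ := d'
    rw [universalTwoNFA_move_iff] at hm
    rcases m with _ | _ | _ | _ | m
    · obtain ⟨-, rfl⟩ := hm
      trivial
    · obtain ⟨rfl, rfl⟩ := hm
      exact fun q hq => .start hq
    · obtain ⟨hs, rfl⟩ := hm
      exact ih s' hs
    · obtain ⟨hnone, rfl, rfl⟩ | ⟨hx, rfl⟩ := hm
      · exact ⟨ih, hnone⟩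
      · exact fun q => .turn ih hx
    · exact hm.elim

theorem mem_language_iff_exists_crosses :
    [.leftState i, .leftTable f, .rightTable g] ∈ (universalTwoNFA n).language ↔
      ∃ q, Crosses (fun x => f.1 x) g.returns i q ∧ none ∈ g.1 q := by
  constructor
  · rintro ⟨s, -, q, -, h⟩
    exact ⟨q, crosses_of_reflTransGen_move h⟩
  · rintro ⟨q, hq, hnone⟩
    refine ⟨⟨0, i.pos⟩, rfl, q, trivial, (reflTransGen_move_of_crosses _ hq).tail ?_⟩
    exact universalTwoNFA_move_iff.2 (.inl ⟨hnone, rfl, rfl⟩)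

end TableWord

/-! ### Computations climbing levels -/

section Levels

variable {X Q : Type*} {f : X → Set Q} {i : X} {k : ℕ} {c : Q → ℕ} {e : X → ℕ}

/-- The states in which a computation that starts in `i` can reach the boundary when all its
returns to the left half are in states of `W`. -/
def arrivals (f : X → Set Q) (i : X) (W : Set X) : Set Q :=
  ⋃ x ∈ insert i W, f x

theorem mem_arrivals {W : Set X} {q : Q} : q ∈ arrivals f i W ↔ q ∈ f i ∨ ∃ x ∈ W, q ∈ f x := by
  simp [arrivals]

/-- A computation on the table `f` that starts in `i` can leave each level `j < k` upwards, where
`c` and `e` are the levels of the states in which it moves right and left across the boundary. -/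
def ClimbsLevels (k : ℕ) (f : X → Set Q) (i : X) (c : Q → ℕ) (e : X → ℕ) : Prop :=
  ∀ j < k, ∃ q ∈ arrivals f i {x | e x ≤ j}, j < c q

theorem exists_crosses_iff_climbsLevels (hk : 0 < k) (he : ∀ x, 0 < e x) :
    (∃ q, Crosses f (fun q => {x | c q < k ∧ e x ≤ c q}) i q ∧ k ≤ c q) ↔
      ClimbsLevels k f i c e := by
  constructor
  · rintro ⟨q, hq, hqk⟩ j hj
    by_contra! hstuck
    have hmem {q : Q} (hq : Crosses f (fun q => {x | c q < k ∧ e x ≤ c q}) i q) :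
        q ∈ arrivals f i {x | e x ≤ j} := by
      induction hq with
      | start hq => exact mem_arrivals.2 (.inl hq)
      | turn _ hx hq' ih => exact mem_arrivals.2 (.inr ⟨_, hx.2.trans (hstuck _ ih), hq'⟩)
    exact (hj.trans_le hqk).not_ge (hstuck q (hmem hq))
  · intro hclimb
    have hreach (j : ℕ) (hj : j < k) :
        ∃ q, Crosses f (fun q => {x | c q < k ∧ e x ≤ c q}) i q ∧ j < c q := by
      induction j with
      | zero =>
        obtain ⟨q, hq, hc⟩ := hclimb 0 hj
        obtain hq | ⟨x, hx, -⟩ := mem_arrivals.1 hq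
        · exact ⟨q, .start hq, hc⟩
        · exact absurd hx (he x).not_ge
      | succ j ih =>
        obtain ⟨q, hq, hc⟩ := hclimb (j + 1) hj
        obtain ⟨q', hq', hc'⟩ := ih (j.lt_succ_self.trans hj)
        obtain hq | ⟨x, hx, hqx⟩ := mem_arrivals.1 hq
        · exact ⟨q, .start hq, hc⟩
        · obtain hlt | heq := (Nat.succ_le_of_lt hc').lt_or_eq
          · exact ⟨q', hq', hlt⟩
          · exact ⟨q, .turn hq' ⟨heq ▸ hj, hx.trans heq.le⟩ hqx, hc⟩
    obtain ⟨q, hq, hc⟩ := hreach (k - 1) (Nat.sub_one_lt_of_lt hk)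
    exact ⟨q, hq, Nat.le_of_pred_lt hc⟩

end Levels

namespace SuffixTable

variable {n k : ℕ} {c e : Fin n → ℕ}

/-- The suffix table with `x ∈ g q` iff `e x ≤ c q`, except that `g q` is full if `k ≤ c q`. -/
def ofLevels (k : ℕ) (c e : Fin n → ℕ) (h : ∃ q, k ≤ c q) : SuffixTable n :=
  ⟨fun q => {y | k ≤ c q ∨ ∃ x, y = some x ∧ e x ≤ c q},
    h.imp fun q hq => by simp [hq], fun q hq => by simp_all⟩

theorem none_mem_ofLevels (h : ∃ q, k ≤ c q) {q : Fin n} :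
    none ∈ (ofLevels k c e h).1 q ↔ k ≤ c q := by
  simp [ofLevels]

theorem returns_ofLevels (h : ∃ q, k ≤ c q) :
    (ofLevels k c e h).returns = fun q => {x | c q < k ∧ e x ≤ c q} := by
  ext q x
  simp only [returns, none_mem_ofLevels, Set.mem_ofPred_eq, not_le]
  refine and_congr_right fun hq => ?_
  simp [ofLevels, hq.not_ge]

end SuffixTable

theorem mem_language_ofLevels_iff_climbsLevels {n k : ℕ} {i : Fin n} {f : PrefixTable n}
    {c e : Fin n → ℕ} (hk : 0 < k) (he : ∀ x, 0 < e x) (h : ∃ q, k ≤ c q) :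
    [.leftState i, .leftTable f, .rightTable (.ofLevels k c e h)] ∈ (universalTwoNFA n).language ↔
      ClimbsLevels k (fun x => f.1 x) i c e := by
  simp only [mem_language_iff_exists_crosses, SuffixTable.returns_ofLevels,
    SuffixTable.none_mem_ofLevels, exists_crosses_iff_climbsLevels hk he]

/-! ### Parity of raised levels -/

section Parity

variable {τ R : Type*} [Semiring R] [CharP R 2]

theorem sum_powerset_eq_zero_of_insert_eq [DecidableEq τ] {s : Finset τ} {x : τ} (hx : x ∈ s)
    {F : Finset τ → R} (hF : ∀ t, x ∉ t → F (insert x t) = F t) :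
    ∑ t ∈ s.powerset, F t = 0 := by
  have hnotMem (t) (ht : t ∈ (s.erase x).powerset) : x ∉ t :=
    fun hxt => s.notMem_erase x (Finset.mem_powerset.1 ht hxt)
  rw [← Finset.insert_erase hx, Finset.sum_powerset_insert (s.notMem_erase x),
    Finset.sum_congr rfl fun t ht => hF t (hnotMem t ht), CharTwo.add_self_eq_zero]

variable (R) in
theorem sum_powerset_iverson_forall_exists_eq {κ : Type*} (φ : τ → κ) (s : Finset τ) :
    ∑ t ∈ s.powerset, iverson R (∀ y ∈ s, ∃ x ∈ t, φ x = φ y) = 1 := by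
  classical
  induction s using Finset.strongInduction with
  | H s ih =>
    by_cases hφ : Set.InjOn φ s
    · rw [Finset.sum_eq_single_of_mem s (Finset.mem_powerset_self s),
        iverson_of_true R fun y hy => ⟨y, hy, rfl⟩]
      intro t ht hts
      rw [Finset.mem_powerset] at ht
      refine iverson_of_not R fun h => hts (ht.antisymm fun y hy => ?_)
      obtain ⟨x, hx, hxy⟩ := h y hy
      exact hφ (ht hx) hy hxy ▸ hx
    · simp only [Set.InjOn, not_forall] at hφ
      obtain ⟨x, hx, y, hy, hxy, hne⟩ := hφ
      have hy' : y ∈ s.erase x := Finset.mem_erase.2 ⟨Ne.symm hne, hy⟩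
      have hiff (t : Finset τ) : (∀ z ∈ insert x (s.erase x), ∃ w ∈ t, φ w = φ z) ↔
          ∀ z ∈ s.erase x, ∃ w ∈ t, φ w = φ z := by
        rw [Finset.forall_mem_insert, and_iff_right_iff_imp]
        exact fun h => hxy ▸ h y hy'
      have hwith : ∑ t ∈ (s.erase x).powerset,
          iverson R (∀ z ∈ s.erase x, ∃ w ∈ insert x t, φ w = φ z) = 0 := by
        refine sum_powerset_eq_zero_of_insert_eq hy' fun t _ => ?_
        simp [hxy]
      rw [← Finset.insert_erase hx, Finset.sum_powerset_insert (s.notMem_erase x)]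
      simp only [hiff, hwith, ih _ (Finset.erase_ssubset hx), add_zero]

end Parity

section Raise

variable {Q : Type*} {k : ℕ} {b : Q → ℕ}

/-- The level function obtained from `b` by raising the levels of the elements of `s` by one. -/
noncomputable def raise (b : Q → ℕ) (s : Set Q) : Q → ℕ :=
  b + s.indicator 1

variable {s : Set Q} {q : Q}

theorem raise_of_mem (hq : q ∈ s) : raise b s q = b q + 1 := by
  simp [raise, hq]

theorem raise_of_notMem (hq : q ∉ s) : raise b s q = b q := by
  simp [raise, hq]

theorem le_raise : b q ≤ raise b s q :=
  Nat.le_add_right _ _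

theorem raise_le_add_one : raise b s q ≤ b q + 1 := by
  by_cases hq : q ∈ s <;> simp [raise, hq]

theorem raise_compl_eq_self_iff : raise b sᶜ q = b q ↔ q ∈ s := by
  by_cases hq : q ∈ s <;> simp [raise, hq]

theorem lt_raise_iff {j : ℕ} : j < raise b s q ↔ j < b q ∨ b q = j ∧ q ∈ s := by
  by_cases hq : q ∈ s
  · simp only [raise_of_mem hq, Nat.lt_succ_iff_lt_or_eq, hq, and_true, eq_comm]
  · simp only [raise_of_notMem hq, hq, and_false, or_false]

/-- Each of the sets `E j` with `j < k` contains exactly the elements of level `j`, apart from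
elements of lower levels. -/
def FillsLevels (k : ℕ) (b : Q → ℕ) (E : ℕ → Set Q) : Prop :=
  ∀ j < k, ∀ q, (b q = j → q ∈ E j) ∧ (q ∈ E j → b q ≤ j)

theorem exists_mem_imp_of_not_fillsLevels {E : ℕ → Set Q} (hb : ∀ j < k, ∃ q, b q = j)
    (hE : ¬FillsLevels k b E) : ∃ r, b r < k ∧ (r ∈ E (b r) → ∃ q ∈ E (b r), b r < b q) := by
  simp only [FillsLevels, not_forall] at hE
  obtain ⟨j, hj, q, hq⟩ := hE
  obtain ⟨r, rfl⟩ := hb j hj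
  by_cases hqr : b q = b r
  · exact ⟨q, hqr ▸ hj, fun hqE => absurd ⟨fun _ => hqr ▸ hqE, fun _ => hqr.le⟩ hq⟩
  · refine ⟨r, hj, fun _ => ⟨q, ?_⟩⟩
    simpa [hqr] using hq

theorem sum_powerset_iverson_lt_raise [Fintype Q] (R : Type*) [Semiring R] [CharP R 2]
    (hb : ∀ j < k, ∃ q, b q = j) (E : ℕ → Set Q) :
    ∑ Z ∈ ({q | b q < k} : Finset Q).powerset,
        iverson R (∀ j < k, ∃ q ∈ E j, j < raise b Z q) =
      iverson R (FillsLevels k b E) := by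
  by_cases hE : FillsLevels k b E
  · rw [iverson_of_true R hE]
    refine (Finset.sum_congr rfl fun Z hZ => iverson_congr R ?_).trans
      (sum_powerset_iverson_forall_exists_eq R b _)
    simp only [Finset.mem_powerset, Finset.subset_iff, Finset.mem_filter_univ] at hZ ⊢
    constructor
    · intro h y hy
      obtain ⟨q, hq, hlt | ⟨hqy, hqZ⟩⟩ := (h (b y) hy).imp fun q => And.imp_right lt_raise_iff.1
      · exact absurd ((hE _ hy q).2 hq) hlt.not_ge
      · exact ⟨q, hqZ, hqy⟩
    · intro h j hj
      obtain ⟨y, rfl⟩ := hb j hj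
      obtain ⟨q, hqZ, hqy⟩ := h y hj
      exact ⟨q, (hE _ hj q).1 hqy, lt_raise_iff.2 (.inr ⟨hqy, hqZ⟩)⟩
  · classical
    rw [iverson_of_not R hE]
    obtain ⟨r, hr, hrE⟩ := exists_mem_imp_of_not_fillsLevels hb hE
    refine sum_powerset_eq_zero_of_insert_eq (x := r) (by simpa using hr) fun Z _ => ?_
    refine iverson_congr R (forall₂_congr fun j _ => ⟨?_, ?_⟩)
    · rintro ⟨q, hq, hlt⟩
      obtain hlt | ⟨rfl, hqZ⟩ := lt_raise_iff.1 hlt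
      · exact ⟨q, hq, lt_raise_iff.2 (.inl hlt)⟩
      · obtain rfl | hqZ := Finset.mem_insert.1 hqZ
        · exact (hrE hq).imp fun q => And.imp_right fun h => lt_raise_iff.2 (.inl h)
        · exact ⟨q, hq, lt_raise_iff.2 (.inr ⟨rfl, hqZ⟩)⟩
    · rintro ⟨q, hq, hlt⟩
      refine ⟨q, hq, lt_raise_iff.2 ((lt_raise_iff.1 hlt).imp_right (And.imp_right ?_))⟩
      exact Finset.mem_insert_of_mem

end Raise

/-! ### Chains of sets -/

section Chain

variable {X Q : Type*} {k k' : ℕ} {a a' : X → ℕ} {b b' : Q → ℕ} {i : X} {e : X → ℕ}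

theorem le_of_lt_imp_lt (hb : ∀ j < k, ∃ q, b q = j) (hbk : ∀ q, b q ≤ k)
    (hlt : ∀ q r, b q < b r → b' q < b' r) (q : Q) : b q ≤ b' q := by
  induction h : b q generalizing q with
  | zero => exact Nat.zero_le _
  | succ j ih =>
    obtain ⟨r, hr⟩ := hb j (Nat.lt_of_succ_le (h.ge.trans (hbk q)))
    exact (ih r hr).trans_lt (hlt r q (by omega))

theorem add_le_add_of_lt_imp_lt (hb : ∀ j < k, ∃ q, b q = j) (hbk : ∀ q, b q ≤ k)
    (hbk' : ∀ q, b' q ≤ k') (hlt : ∀ q r, b q < b r → b' q < b' r)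
    (hltk : ∀ q, b q < k → b' q < k') (q : Q) : b' q + k ≤ b q + k' := by
  induction h : k - b q generalizing q with
  | zero =>
    have := hbk q
    have := hbk' q
    omega
  | succ m ih =>
    obtain hlast | hnext := Nat.eq_or_lt_of_le (show b q + 1 ≤ k by omega)
    · have := hltk q (by omega)
      omega
    · obtain ⟨r, hr⟩ := hb _ hnext
      have := ih r (by omega)
      have := hlt q r (by omega)
      omega

/-- The table in which the states of `Q` reachable from those of `X` are given by levels: its
values form a chain. -/
def chainMap (a : X → ℕ) (b : Q → ℕ) (x : X) : Set Q :=
  {q | b q ≤ a x}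

theorem mem_arrivals_chainMap {W : Set X} {q : Q} :
    q ∈ arrivals (chainMap a b) i W ↔ ∃ x ∈ insert i W, b q ≤ a x := by
  simp [arrivals, chainMap]

theorem le_and_eq_of_fillsLevels_chainMap (hb : ∀ j < k, ∃ q, b q = j) (hbk : ∀ q, b q ≤ k)
    (hbk' : ∀ q, b' q ≤ k') (hak' : ∀ x, a' x < k')
    (h : FillsLevels k b fun j => arrivals (chainMap a' b') i {x | e x ≤ j}) :
    k ≤ k' ∧ (k' = k → b' = b) := by
  have hlt (q r : Q) (hqr : b q < b r) : b' q < b' r := by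
    have hq := hqr.trans_le (hbk r)
    obtain ⟨x, hx, hqx⟩ := mem_arrivals_chainMap.1 ((h _ hq q).1 rfl)
    by_contra! hrq
    exact hqr.not_ge ((h _ hq r).2 (mem_arrivals_chainMap.2 ⟨x, hx, hrq.trans hqx⟩))
  have hltk (q : Q) (hq : b q < k) : b' q < k' := by
    obtain ⟨x, -, hqx⟩ := mem_arrivals_chainMap.1 ((h _ hq q).1 rfl)
    exact hqx.trans_lt (hak' x)
  have hupper := add_le_add_of_lt_imp_lt hb hbk hbk' hlt hltk
  constructor
  · obtain rfl | hk := k.eq_zero_or_pos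
    · exact k'.zero_le
    · obtain ⟨q, hq⟩ := hb 0 hk
      have := hupper q
      omega
  · rintro rfl
    funext q
    have := hupper q
    have := le_of_lt_imp_lt hb hbk hlt q
    omega

/-- The level function `e` lies above `a'`, and they meet on every level strictly between `0` and
`k`. -/
def TouchesLevels (k : ℕ) (a' e : X → ℕ) : Prop :=
  (∀ x, a' x ≤ e x) ∧ ∀ j, 0 < j → j < k → ∃ x, e x = j ∧ a' x = j

theorem fillsLevels_chainMap_iff_touchesLevels (hb : ∀ j < k, ∃ q, b q = j) (ha' : ∀ x, a' x < k)
    (hi : a' i = 0) :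
    FillsLevels k b (fun j => arrivals (chainMap a' b) i {x | e x ≤ j}) ↔
      TouchesLevels k a' e := by
  have hmem (j : ℕ) (q : Q) : q ∈ arrivals (chainMap a' b) i {x | e x ≤ j} ↔
      b q = 0 ∨ ∃ x, e x ≤ j ∧ b q ≤ a' x := by
    simp [mem_arrivals_chainMap, hi]
  simp only [FillsLevels, hmem]
  constructor
  · intro h
    have hle (x : X) : a' x ≤ e x := by
      by_contra! hx
      obtain ⟨q, hq⟩ := hb _ (ha' x)
      exact hx.not_ge (hq ▸ (h (e x) (hx.trans (ha' x)) q).2 (.inr ⟨x, le_rfl, hq.le⟩))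
    refine ⟨hle, fun j hj hjk => ?_⟩
    obtain ⟨q, rfl⟩ := hb j hjk
    obtain hq | ⟨x, hex, hqx⟩ := (h _ hjk q).1 rfl
    · exact absurd hq hj.ne'
    · exact ⟨x, hex.antisymm (hqx.trans (hle x)), (hle x |>.trans hex).antisymm hqx⟩
  · rintro ⟨hle, hex⟩ j hj q
    constructor
    · rintro rfl
      refine (b q).eq_zero_or_pos.imp_right fun hq => ?_
      obtain ⟨x, hx, hx'⟩ := hex _ hq hj
      exact ⟨x, hx.le, hx'.ge⟩
    · rintro (hq | ⟨x, hx, hqx⟩)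
      · exact hq ▸ j.zero_le
      · exact hqx.trans ((hle x).trans hx)

theorem exists_le_and_exists_lt_of_ne [Finite X] (ha : ∀ j, 0 < j → j < k → ∃ x, a x = j)
    (ha' : ∀ x, a' x < k) (hne : a' ≠ a) :
    ∃ y, a y ≠ 0 ∧ a' y ≤ a y ∧ (a' y = a y → ∃ x, a x + 1 = a y ∧ a x < a' x) := by
  by_cases hle : ∃ y, a' y < a y
  · obtain ⟨y, hy⟩ := hle
    exact ⟨y, hy.ne_bot, hy.le, fun h => absurd h hy.ne⟩
  · push Not at hle
    obtain ⟨x, hx, hmax⟩ := Set.exists_max_image {x | a x < a' x} a (Set.toFinite _) <| by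
      by_contra! hempty
      exact hne (funext fun x => le_antisymm (not_lt.1 fun h => hempty.subset h) (hle x))
    obtain ⟨y, hy⟩ := ha (a x + 1) (Nat.succ_pos _) ((Nat.succ_le_of_lt hx).trans_lt (ha' x))
    refine ⟨y, hy ▸ Nat.succ_ne_zero _, not_lt.1 fun h => ?_, fun _ => ⟨x, hy.symm, hx⟩⟩
    exact (hmax y h).not_gt (hy ▸ Nat.lt_succ_self _)

theorem touchesLevels_raise_compl_insert_iff [DecidableEq X] {V : Finset X} {y : X} (hyV : y ∉ V)
    (hy : a' y ≤ a y) (heq : a' y = a y → ∃ x, a x + 1 = a y ∧ a x < a' x) :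
    TouchesLevels k a' (raise a (↑(insert y V))ᶜ) ↔ TouchesLevels k a' (raise a (↑V)ᶜ) := by
  have hother {x : X} (hx : x ≠ y) : raise a (↑(insert y V))ᶜ x = raise a (↑V)ᶜ x := by
    simp [raise, Set.indicator_apply, hx]
  have hins : raise a (↑(insert y V))ᶜ y = a y := by simp [raise]
  have hy' : raise a (↑V)ᶜ y = a y + 1 := raise_of_mem (by simpa using hyV)
  have hbelow : (∀ x, a' x ≤ raise a (↑(insert y V))ᶜ x) ↔ ∀ x, a' x ≤ raise a (↑V)ᶜ x := by
    refine forall_congr' fun x => ?_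
    obtain rfl | hx := eq_or_ne x y
    · exact iff_of_true (hy.trans le_raise) (hy.trans le_raise)
    · rw [hother hx]
  simp only [TouchesLevels, hbelow]
  refine and_congr_right fun hle => forall_congr' fun j => forall₂_congr fun _ _ => ⟨?_, ?_⟩
  · rintro ⟨x, hxj, rfl⟩
    obtain rfl | hx := eq_or_ne x y
    · obtain ⟨z, hz, hlt⟩ := heq (hxj.symm.trans hins)
      have := hle z
      have : raise a (↑V)ᶜ z ≤ a z + 1 := raise_le_add_one
      exact ⟨z, by omega, by omega⟩
    · exact ⟨x, hother hx ▸ hxj, rfl⟩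
  · rintro ⟨x, hxj, rfl⟩
    have hx : x ≠ y := by
      rintro rfl
      omega
    exact ⟨x, (hother hx).trans hxj, rfl⟩

theorem sum_powerset_iverson_touchesLevels [Fintype X] (R : Type*) [Semiring R] [CharP R 2]
    (ha : ∀ j, 0 < j → j < k → ∃ x, a x = j) (hak : ∀ x, a x < k) (ha' : ∀ x, a' x < k) :
    ∑ V ∈ ({x | a x ≠ 0} : Finset X).powerset, iverson R (TouchesLevels k a' (raise a (↑V)ᶜ)) =
      iverson R (a' = a) := by
  by_cases heq : a' = a
  · subst heq
    rw [iverson_of_true R rfl]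
    refine (Finset.sum_congr rfl fun V _ => iverson_congr R ?_).trans
      (sum_powerset_iverson_forall_exists_eq R a' _)
    simp only [TouchesLevels, le_raise, implies_true, true_and, Finset.mem_filter_univ]
    constructor
    · intro h y hy
      obtain ⟨x, hx, hxy⟩ := h (a' y) (Nat.pos_of_ne_zero hy) (hak y)
      exact ⟨x, raise_compl_eq_self_iff.1 (hx.trans hxy.symm), hxy⟩
    · intro h j hj hjk
      obtain ⟨y, rfl⟩ := ha j hj hjk
      obtain ⟨x, hx, hxy⟩ := h y hj.ne'
      exact ⟨x, (raise_compl_eq_self_iff.2 hx).trans hxy, hxy⟩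
  · classical
    obtain ⟨y, hy0, hy, hyx⟩ := exists_le_and_exists_lt_of_ne ha ha' heq
    rw [iverson_of_not R heq]
    exact sum_powerset_eq_zero_of_insert_eq (by simpa using hy0) fun V hyV =>
      iverson_congr R (touchesLevels_raise_compl_insert_iff hyV hy hyx)

theorem sum_iverson_climbsLevels_chainMap [Fintype X] [Fintype Q] (R : Type*) [Semiring R]
    [CharP R 2] (ha : ∀ j, 0 < j → j < k → ∃ x, a x = j) (hak : ∀ x, a x < k)
    (hb : ∀ j < k, ∃ q, b q = j) (hbk : ∀ q, b q ≤ k) (hak' : ∀ x, a' x < k')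
    (hbk' : ∀ q, b' q ≤ k') (hi : a' i = 0) (hk : k' ≤ k) :
    ∑ V ∈ ({x | a x ≠ 0} : Finset X).powerset, ∑ Z ∈ ({q | b q < k} : Finset Q).powerset,
        iverson R (ClimbsLevels k (chainMap a' b') i (raise b Z) (raise a (↑V)ᶜ)) =
      iverson R (k' = k ∧ a' = a ∧ b' = b) := by
  simp only [ClimbsLevels, sum_powerset_iverson_lt_raise R hb]
  by_cases h : k' = k ∧ b' = b
  · obtain ⟨rfl, rfl⟩ := h
    simp only [fillsLevels_chainMap_iff_touchesLevels hb hak' hi,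
      sum_powerset_iverson_touchesLevels R ha hak hak', true_and, and_true]
  · rw [iverson_of_not R fun h' => h ⟨h'.1, h'.2.2⟩]
    refine Finset.sum_eq_zero fun V _ => iverson_of_not R fun hfills => h ?_
    obtain ⟨hle, heq⟩ := le_and_eq_of_fillsLevels_chainMap hb hbk hbk' hak' hfills
    have hkk := hk.antisymm hle
    exact ⟨hkk, heq hkk⟩

end Chain

/-! ### Chain tables -/

/-- A prefix table whose values form a chain, given by levels as in `chainMap`: the least value
consists of the elements of level `0`, and each of the `k` values contains exactly one more level
than the preceding one. Level `k` consists of the elements that are in no value. -/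
@[ext]
structure ChainTable (n k : ℕ) where
  col : Fin n → Fin k
  col_surjective : col.Surjective
  row : Fin n → Fin (k + 1)
  compl_last_subset_range_row : {Fin.last k}ᶜ ⊆ Set.range row

namespace ChainTable

variable {n k k' : ℕ}

def equivProd : ChainTable n k ≃
    {f : Fin n → Fin k // f.Surjective} ×
      {f : Fin n → Fin (k + 1) // {Fin.last k}ᶜ ⊆ Set.range f} where
  toFun t := (⟨t.col, t.col_surjective⟩, ⟨t.row, t.compl_last_subset_range_row⟩)
  invFun p := ⟨p.1.1, p.1.2, p.2.1, p.2.2⟩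

instance : Finite (ChainTable n k) :=
  .of_equiv _ equivProd.symm

noncomputable instance : Fintype (ChainTable n k) :=
  .ofFinite _

theorem card_eq : Fintype.card (ChainTable n k) =
    k.factorial * Nat.stirlingSecond n k *
      (k.factorial * Nat.stirlingSecond (n + 1) (k + 1)) := by
  rw [← Nat.card_eq_fintype_card, Nat.card_congr equivProd, Nat.card_prod, card_surjective_fin,
    card_compl_last_subset_range, Nat.card_fin]

theorem exists_row_eq (t : ChainTable n k) {j : ℕ} (hj : j < k) : ∃ q, (t.row q : ℕ) = j := by
  obtain ⟨q, hq⟩ := t.compl_last_subset_range_row (a := ⟨j, hj.trans k.lt_succ_self⟩)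
    (Fin.ne_of_lt hj)
  exact ⟨q, congrArg Fin.val hq⟩

theorem exists_col_eq (t : ChainTable n k) {j : ℕ} (hj : j < k) : ∃ x, (t.col x : ℕ) = j :=
  (t.col_surjective ⟨j, hj⟩).imp fun _ => congrArg Fin.val

section Word

variable [NeZero k]

/-- A state of level `0`: the value of the chain table at it is the least one. -/
noncomputable def leastState (t : ChainTable n k) : Fin n :=
  Function.surjInv t.col_surjective 0

theorem col_leastState (t : ChainTable n k) : (t.col t.leastState : ℕ) = 0 := by
  rw [leastState, Function.surjInv_eq t.col_surjective, Fin.val_zero]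

/-- The prefix table with the values of the chain table. -/
noncomputable def toPrefixTable (t : ChainTable n k) : PrefixTable n :=
  ⟨fun x => {q | (t.row q : ℕ) ≤ t.col x}, fun x => by
    obtain ⟨q, hq⟩ := t.exists_row_eq k.pos_of_neZero
    exact ⟨q, by simp [hq]⟩,
  t.leastState, fun x => Finset.monotone_filter_right _ fun q _ hq => by
    rw [col_leastState] at hq
    exact hq.trans (Nat.zero_le _)⟩

theorem coe_toPrefixTable (t : ChainTable n k) :
    (fun x => (t.toPrefixTable.1 x : Set (Fin n))) =
      chainMap (fun x => t.col x) fun q => t.row q := by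
  ext x q
  simp [toPrefixTable, chainMap]

/-- The word of two symbols after which a computation on the chain table starts in its least
state. -/
noncomputable def word (t : ChainTable n k) : List (UniversalAlphabet n) :=
  [.leftState t.leastState, .leftTable t.toPrefixTable]

end Word

open Classical in
/-- A combination of columns of the acceptance matrix that singles out the row of the chain table
`t` among the rows of the chain tables with at most as many levels. The columns are those of the
suffix tables with the levels of `t`, some of them raised by one. A level function that does not
reach `k` defines no suffix table; no computation climbs it, so its column counts as zero. -/
noncomputable def functional (t : ChainTable n k) :
    Module.Dual (ZMod 2) (List (UniversalAlphabet n) → ZMod 2) :=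
  ∑ V ∈ ({x | (t.col x : ℕ) ≠ 0} : Finset (Fin n)).powerset,
    ∑ Z ∈ ({q | (t.row q : ℕ) < k} : Finset (Fin n)).powerset,
      if h : ∃ q, k ≤ raise (fun q => (t.row q : ℕ)) Z q then
        LinearMap.proj
          [.rightTable (.ofLevels k _ (raise (fun x => (t.col x : ℕ)) (↑V)ᶜ) h)]
      else 0

theorem functional_acceptanceRow (t : ChainTable n k) [NeZero k'] (t' : ChainTable n k')
    (hk : k' ≤ k) :
    t.functional (acceptanceRow (ZMod 2) (universalTwoNFA n).language t'.word) =
      iverson (ZMod 2) (k' = k ∧ (fun x => (t'.col x : ℕ)) = (fun x => (t.col x : ℕ)) ∧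
        (fun q => (t'.row q : ℕ)) = fun q => (t.row q : ℕ)) := by
  have hk0 : 0 < k := k'.pos_of_neZero.trans_le hk
  rw [← sum_iverson_climbsLevels_chainMap (ZMod 2) (fun j _ hj => t.exists_col_eq hj)
    (fun x => (t.col x).2) (fun j hj => t.exists_row_eq hj) (fun q => (t.row q).is_le)
    (fun x => (t'.col x).2) (fun q => (t'.row q).is_le) t'.col_leastState hk, functional]
  simp only [LinearMap.sum_apply]
  refine Finset.sum_congr rfl fun V hV => Finset.sum_congr rfl fun Z _ => ?_
  have hpos (x : Fin n) : 0 < raise (fun x => (t.col x : ℕ)) (↑V)ᶜ x := by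
    rw [lt_raise_iff]
    refine (Nat.eq_zero_or_pos _).symm.imp_right fun hx => ⟨hx, fun hxV => ?_⟩
    exact (Finset.mem_filter_univ x).1 (Finset.mem_powerset.1 hV hxV) hx
  split_ifs with h
  · rw [LinearMap.proj_apply, acceptanceRow, word, ← coe_toPrefixTable]
    exact iverson_congr _ (mem_language_ofLevels_iff_climbsLevels hk0 hpos h)
  · refine (iverson_of_not _ fun hclimb => h ?_).symm
    obtain ⟨q, -, hq⟩ := hclimb (k - 1) (Nat.sub_one_lt_of_lt hk0)
    exact ⟨q, Nat.le_of_pred_lt hq⟩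

end ChainTable

theorem linearIndependent_acceptanceRow_word (n : ℕ) :
    LinearIndependent (ZMod 2) fun t : (k : Fin n) × ChainTable n (k + 1) =>
      acceptanceRow (ZMod 2) (universalTwoNFA n).language t.2.word := by
  refine linearIndependent_of_triangular_dual (fun t => t.1) (fun t => t.2.functional)
    (fun t => ?_) ?_
  · rw [t.2.functional_acceptanceRow t.2 le_rfl, iverson_of_true _ ⟨rfl, rfl, rfl⟩]
  · rintro ⟨k, t⟩ ⟨k', t'⟩ hne hk
    rw [t.functional_acceptanceRow t' (Nat.succ_le_succ hk)]
    refine iverson_of_not _ ?_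
    rintro ⟨hkk, hcol, hrow⟩
    obtain rfl : k' = k := Fin.ext (Nat.succ_injective hkk)
    refine hne (congrArg _ (ChainTable.ext ?_ ?_))
    exacts [funext fun x => Fin.ext (congrFun hcol x), funext fun q => Fin.ext (congrFun hrow q)]

theorem mainTheorem1 (n : ℕ) {σ : Type*} [Fintype σ]
    (B : NFA (UniversalAlphabet n) σ) (hB : B.IsUnambiguous)
    (hL : B.accepts = (universalTwoNFA n).language) :
    ∑ k ∈ Finset.Icc 1 n,
        (k - 1).factorial * k.factorial * Nat.stirlingSecond n k * Nat.stirlingSecond (n + 1) k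
      ≤ Fintype.card σ := by
  calc
    _ = Fintype.card ((k : Fin n) × ChainTable n (k + 1)) := by
      rw [sum_Icc_mul_factorial_mul_stirlingSecond, Fintype.card_sigma]
      simp only [ChainTable.card_eq]
    _ ≤ Fintype.card σ :=
      card_le_card_states_of_linearIndependent hB
        (hL ▸ linearIndependent_acceptanceRow_word n)
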